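/- Let $\mathcal C$ be a category. Call a pair of monomorphisms $\iota_0:H\to G_0$, $\iota_1:H\to G_1$ in $\mathcal C$ *coherently embeddable* if there are an object $G$ and monomorphisms $j_0:G_0\to G$, $j_1:G_1\to G$ with $j_0\iota_0=j_1\iota_1$. (a) Suppose that $\mathcal C$ has pushouts and that every monomorphism of $\mathcal C$ is regular (that is, is an equalizer of some parallel pair). Let $\iota_0:H\to G_0$, $\iota_1:H\to G_1$ be a coherently embeddable pair of monomorphisms in $\mathcal C$. Then the pushout square $$\begin{array}{ccc} H & \xrightarrow{\ \iota_0\ } & G_0\\ {\scriptstyle\iota_1}\downarrow & & \downarrow\\ G_1 & \longrightarrow & G_0\coprod_H G_1\end{array}$$ is also a pullback square. (b) Let $\mathbf{CGp}$ be the category of compact Hausdorff topological groups and continuous group homomorphisms. Then $\mathbf{CGp}$ has pushouts, and if $\iota_0:H\to G_0$, $\iota_1:H\to G_1$ is a coherently embeddable pair of monomorphisms in $\mathbf{CGp}$, then the structure maps $p_i:G_i\to G_0\coprod_H G_1$ ($i=0,1$) of the pushout in $\mathbf{CGp}$ are injective and, identifying $G_0$, $G_1$ and $H$ with their images in $G_0\coprod_H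 G_1$, one has $G_0\cap G_1=H$; that is, $p_0(G_0)\cap p_1(G_1)=p_0\iota_0(H)$. -/

import Mathlib

open CategoryTheory CategoryTheory.Limits

universe u v w

/-- The category of compact groups: an object is a compact Hausdorff topological group. -/
structure CompactGrp where
  /-- The underlying type. -/
  carrier : Type u
  [group : Group carrier]
  [topologicalSpace : TopologicalSpace carrier]
  [isTopologicalGroup : IsTopologicalGroup carrier]
  [compactSpace : CompactSpace carrier]
  [t2Space : T2Space carrier]

namespace CompactGrp

instance : CoeSort CompactGrp.{u} (Type u) where
  coe G := G.carrier

attribute [instance] CompactGrp.group CompactGrp.topologicalSpace CompactGrp.isTopologicalGroup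
  CompactGrp.compactSpace CompactGrp.t2Space

/-- A morphism of compact groups is a continuous group homomorphism. -/
@[ext]
structure Hom (A B : CompactGrp.{u}) where
  /-- The underlying continuous homomorphism. -/
  hom' : A →ₜ* B

instance : Category CompactGrp.{u} where
  Hom A B := Hom A B
  id A := ⟨ContinuousMonoidHom.id A⟩
  comp f g := ⟨g.hom'.comp f.hom'⟩

instance : ConcreteCategory CompactGrp.{u} (fun A B => A →ₜ* B) where
  hom f := f.hom'
  ofHom f := ⟨f⟩

end CompactGrp

/-- A pair of morphisms `H ⟶ G₀`, `H ⟶ G₁` (in the applications: monomorphisms) is coherently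
embeddable if there are monomorphisms from `G₀` and `G₁` into a common object which agree
on `H`. -/
def CoherentlyEmbeddable {C : Type u} [Category.{v} C] {H G₀ G₁ : C}
    (ι₀ : H ⟶ G₀) (ι₁ : H ⟶ G₁) : Prop :=
  ∃ (G : C) (j₀ : G₀ ⟶ G) (j₁ : G₁ ⟶ G), Mono j₀ ∧ Mono j₁ ∧ ι₀ ≫ j₀ = ι₁ ≫ j₁

/-! For (a), write `ι₀ ≫ j₀` as the equalizer of `r.left` and `r.right`. Besides the map `φ` out of
`P` induced by `j₀`, `j₁`, there is a map `ψ` induced by `j₀ ≫ r.left`, `j₁ ≫ r.right`. If `a ≫ p₀ =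
b ≫ p₁`, then `φ` and `ψ` together show that `a ≫ j₀` equalizes the pair, hence factors through `H`.

For (b) the same argument runs one point at a time, so it is enough to separate a point from a
closed subgroup by two homomorphisms agreeing on the subgroup (`exists_continuousMonoidHom_pair`).
Peter–Weyl theory supplies an orthogonal representation with a vector fixed by the subgroup and
moved by the point; conjugating by the reflection along that vector, after adding a trivial summand,
gives the second homomorphism.

Pushouts exist because orthogonal representations separate points: the pushout is the closed
subgroup generated by both legs in the product of all compatible pairs of orthogonal
representations, a set-indexed product. -/

/-! ### Compactness of integral-type operators -/

section CompactOperators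

variable {X E : Type*} [TopologicalSpace X] [CompactSpace X] [NormedAddCommGroup E]
  [InnerProductSpace ℝ E]

/-- The operator sending a vector `φ` to the function `x ↦ ⟪κ x, φ⟫`. -/
noncomputable def innerOperator (κ : C(X, E)) : E →L[ℝ] C(X, ℝ) :=
  LinearMap.mkContinuous
    { toFun := fun φ => ⟨fun x => inner ℝ (κ x) φ, by fun_prop⟩
      map_add' := fun φ ψ => by ext x; simp [inner_add_right]
      map_smul' := fun c φ => by ext x; simp [inner_smul_right] } ‖κ‖ fun φ => by
    refine (ContinuousMap.norm_le _ (by positivity)).2 fun x => ?_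
    exact (norm_inner_le_norm _ _).trans (by gcongr; exact κ.norm_coe_le_norm x)

@[simp]
theorem innerOperator_apply (κ : C(X, E)) (φ : E) (x : X) :
    innerOperator κ φ x = inner ℝ (κ x) φ := rfl

/-- Arzelà–Ascoli: on the unit ball, Cauchy–Schwarz gives the uniform bound `‖κ‖` and the common
modulus of continuity `dist (κ x₀) (κ x)`. -/
theorem isCompactOperator_innerOperator (κ : C(X, E)) : IsCompactOperator (innerOperator κ) := by
  let e := ContinuousMap.linearIsometryBoundedOfCompact X ℝ ℝ
  let S : E →L[ℝ] BoundedContinuousFunction X ℝ := (e : C(X, ℝ) →L[ℝ] _) ∘L innerOperator κ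
  have hS : IsCompactOperator S := by
    refine (isCompactOperator_iff_isCompact_closure_image_closedBall
      (S : E →ₗ[ℝ] BoundedContinuousFunction X ℝ) one_pos).2 ?_
    refine BoundedContinuousFunction.arzela_ascoli (Metric.closedBall 0 ‖κ‖)
      (isCompact_closedBall 0 ‖κ‖) _ ?_ ?_
    · rintro _ x ⟨φ, hφ, rfl⟩
      rw [mem_closedBall_zero_iff] at hφ ⊢
      refine (norm_inner_le_norm (𝕜 := ℝ) (κ x) φ).trans ?_
      exact (mul_le_of_le_one_right (norm_nonneg _) hφ).trans (κ.norm_coe_le_norm x)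
    · intro x₀
      refine Metric.equicontinuousAt_of_continuity_modulus (fun x => dist (κ x₀) (κ x)) ?_ _ ?_
      · have : Continuous fun x => dist (κ x₀) (κ x) := by fun_prop
        simpa using this.tendsto x₀
      · refine Filter.Eventually.of_forall ?_
        rintro x ⟨_, φ, hφ, rfl⟩
        rw [mem_closedBall_zero_iff] at hφ
        change dist (inner ℝ (κ x₀) φ) (inner ℝ (κ x) φ) ≤ _
        rw [dist_eq_norm, ← inner_sub_left, dist_eq_norm]
        exact (norm_inner_le_norm (𝕜 := ℝ) _ φ).trans
          (mul_le_of_le_one_right (norm_nonneg _) hφ)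
  exact hS.clm_comp (e.symm : BoundedContinuousFunction X ℝ →L[ℝ] C(X, ℝ))

end CompactOperators

/-! ### Finite-dimensional pieces of orthogonal representations -/

section OrthogonalRepresentations

variable {G E : Type*} [Group G] [NormedAddCommGroup E] [InnerProductSpace ℝ E]

/-- If a compact symmetric operator commuting with an orthogonal representation distinguishes `f`
from its translate by `g`, then the orthogonal projection of `f` to some finite-dimensional
eigenspace is moved by `g`. -/
theorem exists_finiteDimensional_invariant_submodule [CompleteSpace E]
    (π : G →* (E ≃ₗᵢ[ℝ] E)) {T : E →L[ℝ] E}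
    (hT : IsCompactOperator T) (hs : T.IsSymmetric) (hc : ∀ x φ, T (π x φ) = π x (T φ))
    {f : E} {g : G} (hf : T (π g f) ≠ T f) :
    ∃ V : Submodule ℝ E, FiniteDimensional ℝ V ∧ (∀ x, ∀ φ ∈ V, π x φ ∈ V) ∧
      ∃ v ∈ V, π g v ≠ v ∧ ∀ h, π h f = f → π h v = v := by
  -- Spectral theorem: a nonzero vector cannot be orthogonal to every eigenspace.
  have key : ∃ μ, ∃ e ∈ Module.End.eigenspace (T : Module.End ℝ E) μ,
      inner ℝ (T (π g f - f)) e ≠ 0 := by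
    by_contra! hcon
    have hmem : T (π g f - f) ∈ (⨆ μ, Module.End.eigenspace (T : Module.End ℝ E) μ)ᗮ := by
      rw [Submodule.mem_orthogonal']
      intro e he
      induction he using Submodule.iSup_induction' with
      | mem μ e he => exact hcon μ e he
      | zero => simp
      | add a b _ _ ha hb => rw [inner_add_right, ha, hb, add_zero]
    rw [ContinuousLinearMap.orthogonalComplement_iSup_eigenspaces_eq_bot hT hs,
      Submodule.mem_bot, map_sub, sub_eq_zero] at hmem
    exact hf hmem
  obtain ⟨μ, e, he, hne⟩ := key
  have hTe : T e = μ • e := Module.End.mem_eigenspace_iff.1 he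
  -- Both factors are nonzero: `μ ≠ 0` makes the eigenspace finite-dimensional, and the other factor
  -- shows that `g` moves the projection of `f`.
  have hne' : inner ℝ (T (π g f - f)) e = μ * inner ℝ (π g f - f) e := by
    rw [show inner ℝ (T (π g f - f)) e = inner ℝ (π g f - f) (T e) from hs _ _, hTe,
      inner_smul_right]
  rw [hne'] at hne
  have hμ : μ ≠ 0 := left_ne_zero_of_mul hne
  have hu := right_ne_zero_of_mul hne
  let V := Module.End.eigenspace (T : Module.End ℝ E) μ
  have hV : FiniteDimensional ℝ V := ContinuousLinearMap.finite_dimensional_eigenspace hT μ hμ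
  have hinv : ∀ x, ∀ φ ∈ V, π x φ ∈ V := by
    intro x φ hφ
    have hφ' : T φ = μ • φ := Module.End.mem_eigenspace_iff.1 hφ
    refine Module.End.mem_eigenspace_iff.2 ?_
    change T (π x φ) = _
    rw [hc, hφ', map_smul]
  have hproj : ∀ x, V.starProjection (π x f) = π x (V.starProjection f) := by
    intro x
    refine Submodule.eq_starProjection_of_mem_of_inner_eq_zero
      (hinv x _ (Submodule.starProjection_apply_mem _ _)) ?_
    intro w hw
    have hw' : w = π x (π x⁻¹ w) := by
      change w = (π x * π x⁻¹) w
      rw [← map_mul, mul_inv_cancel, map_one]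
      rfl
    rw [hw', ← map_sub, LinearIsometryEquiv.inner_map_map]
    exact Submodule.starProjection_inner_eq_zero _ _ (hinv _ _ hw)
  refine ⟨V, hV, hinv, V.starProjection f, Submodule.starProjection_apply_mem _ _, ?_, ?_⟩
  · intro h
    apply hu
    have h1 := Submodule.starProjection_inner_eq_zero (K := V) (π g f) e he
    have h2 := Submodule.starProjection_inner_eq_zero (K := V) f e he
    rw [hproj, h, inner_sub_left] at h1
    rw [inner_sub_left] at h2 ⊢
    linarith
  · intro h hh
    rw [← hproj, hh]

/-- A finite-dimensional invariant subspace of a strongly continuous orthogonal representation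
gives a continuous homomorphism to an orthogonal group. -/
theorem exists_continuousMonoidHom_orthogonalGroup [TopologicalSpace G]
    (π : G →* (E ≃ₗᵢ[ℝ] E)) (hπ : ∀ φ, Continuous fun x => π x φ)
    (V : Submodule ℝ E) [FiniteDimensional ℝ V] (hV : ∀ x, ∀ φ ∈ V, π x φ ∈ V) (v : V) :
    ∃ (n : ℕ) (ρ : G →ₜ* Matrix.orthogonalGroup (Fin n) ℝ) (w : Fin n → ℝ),
      ∀ x, (ρ x).1.mulVec w = w ↔ π x v = v := by
  let b := stdOrthonormalBasis ℝ V
  let r : G →* (V →ₗ[ℝ] V) :=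
    { toFun := fun x => (π x).toLinearEquiv.toLinearMap.restrict (hV x)
      map_one' := by ext; simp
      map_mul' := fun x y => by ext; simp }
  have hr : ∀ x (φ : V), (r x φ : E) = π x φ := fun x φ => rfl
  have hinner : ∀ x (φ ψ : V), inner ℝ (r x φ) (r x ψ) = inner ℝ φ ψ := fun x φ ψ => by
    rw [Submodule.coe_inner, hr, hr, LinearIsometryEquiv.inner_map_map, Submodule.coe_inner]
  let e := LinearMap.toMatrixOrthonormal b
  have hmem : ∀ x, e (r x) ∈ Matrix.orthogonalGroup (Fin (Module.finrank ℝ V)) ℝ := by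
    intro x
    refine Matrix.mem_unitaryGroup_iff'.2 ?_
    rw [← map_star, ← map_mul]
    have : star (r x) * r x = 1 := by
      rw [LinearMap.star_eq_adjoint]
      refine LinearMap.ext fun φ => ext_inner_right ℝ fun ψ => ?_
      rw [Module.End.mul_apply, LinearMap.adjoint_inner_left, hinner, Module.End.one_apply]
    rw [this, map_one]
  have hentry : ∀ x i j, e (r x) i j = inner ℝ (b i : E) (π x (b j)) := by
    intro x i j
    change LinearMap.toMatrix b.toBasis b.toBasis (r x) i j = _
    rw [LinearMap.toMatrix_apply]
    simp only [OrthonormalBasis.coe_toBasis, OrthonormalBasis.coe_toBasis_repr_apply,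
      OrthonormalBasis.repr_apply_apply]
    rfl
  refine ⟨Module.finrank ℝ V,
    { toFun := fun x => ⟨e (r x), hmem x⟩
      map_one' := Subtype.ext (by simp)
      map_mul' := fun x y => Subtype.ext (by simp)
      continuous_toFun := ?_ }, b.toBasis.repr v, fun x => ?_⟩
  · refine Continuous.subtype_mk (continuous_matrix fun i j => ?_) _
    simp only [hentry]
    exact continuous_const.inner (hπ _)
  · have : (e (r x)).mulVec (b.toBasis.repr v) = b.toBasis.repr (r x v) :=
      LinearMap.toMatrix_mulVec_repr b.toBasis b.toBasis (r x) v
    change (e (r x)).mulVec (b.toBasis.repr v) = _ ↔ _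
    rw [this, DFunLike.coe_fn_eq, EmbeddingLike.apply_eq_iff_eq, Subtype.ext_iff, hr]

end OrthogonalRepresentations

/-! ### Convolution operators on `L²` -/

section RegularRepresentation

open MeasureTheory DomMulAct

variable (G : Type*) [Group G] [TopologicalSpace G] [IsTopologicalGroup G] [CompactSpace G]
  [MeasurableSpace G] [BorelSpace G]

/-- The left regular representation of a compact group on the real Hilbert space `L²`. -/
noncomputable def regularRepresentation (μ : Measure G) [μ.IsHaarMeasure] :
    G →* (Lp ℝ 2 μ ≃ₗᵢ[ℝ] Lp ℝ 2 μ) where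
  toFun x :=
    { toFun := fun φ => mk x⁻¹ • φ
      invFun := fun φ => mk x • φ
      map_add' := fun φ ψ => smul_add _ φ ψ
      map_smul' := fun c φ => smul_comm _ c φ
      left_inv := fun φ => by simp [smul_smul]
      right_inv := fun φ => by simp [smul_smul]
      norm_map' := fun φ => norm_smul_Lp _ φ }
  map_one' := by
    ext1 φ
    change mk (1 : G)⁻¹ • φ = φ
    simp
  map_mul' x y := by
    ext1 φ
    change mk (x * y)⁻¹ • φ = mk x⁻¹ • (mk y⁻¹ • φ)
    rw [smul_smul, ← mk_mul, mul_inv_rev]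

variable {G} (μ : Measure G) [μ.IsHaarMeasure]

theorem continuous_regularRepresentation [μ.InnerRegularCompactLTTop] (φ : Lp ℝ 2 μ) :
    Continuous fun x => regularRepresentation G μ x φ := by
  have : Fact ((2 : ENNReal) ≠ ⊤) := ⟨by simp⟩
  change Continuous fun x : G => mk x⁻¹ • φ
  exact (continuous_mk.comp continuous_inv).smul continuous_const

theorem regularRepresentation_toLp (x : G) (f : C(G, ℝ)) :
    regularRepresentation G μ x (ContinuousMap.toLp 2 μ ℝ f) =
      ContinuousMap.toLp 2 μ ℝ (f.comp ⟨fun y => x⁻¹ * y, by fun_prop⟩) := by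
  rfl

/-- The family of translates `y ↦ k (y⁻¹ * x)` of a continuous function, as elements of `L²`. -/
noncomputable def convolutionKernel (k : C(G, ℝ)) : C(G, Lp ℝ 2 μ) :=
  ContinuousMap.comp ⟨ContinuousMap.toLp 2 μ ℝ, ContinuousLinearMap.continuous _⟩
    (ContinuousMap.curry ⟨fun p : G × G => k (p.2⁻¹ * p.1), by fun_prop⟩)

theorem convolutionKernel_apply (k : C(G, ℝ)) (x : G) :
    convolutionKernel μ k x =
      ContinuousMap.toLp 2 μ ℝ (k.comp ⟨fun y => y⁻¹ * x, by fun_prop⟩) := rfl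

/-- Right convolution by a continuous function, as an operator on `L²`. -/
noncomputable def convolutionOperator (k : C(G, ℝ)) : Lp ℝ 2 μ →L[ℝ] Lp ℝ 2 μ :=
  ContinuousMap.toLp 2 μ ℝ ∘L innerOperator (convolutionKernel μ k)

theorem isCompactOperator_convolutionOperator (k : C(G, ℝ)) :
    IsCompactOperator (convolutionOperator μ k) :=
  (isCompactOperator_innerOperator (convolutionKernel μ k)).clm_comp (ContinuousMap.toLp 2 μ ℝ)

theorem innerOperator_convolutionKernel_toLp (k f : C(G, ℝ)) (x : G) :
    innerOperator (convolutionKernel μ k) (ContinuousMap.toLp 2 μ ℝ f) x =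
      ∫ y, f y * k (y⁻¹ * x) ∂μ := by
  rw [innerOperator_apply, convolutionKernel_apply, ContinuousMap.inner_toLp]
  rfl

/-- By density it suffices to treat continuous functions, where Fubini exchanges the variables and
the symmetry of `k` matches the integrands. -/
theorem isSymmetric_convolutionOperator [T2Space G] [μ.WeaklyRegular] {k : C(G, ℝ)} (hk : ∀ x, k x⁻¹ = k x) :
    (convolutionOperator μ k).IsSymmetric := by
  intro φ ψ
  have hd : DenseRange (ContinuousMap.toLp 2 μ ℝ : C(G, ℝ) →L[ℝ] Lp ℝ 2 μ) :=
    ContinuousMap.toLp_denseRange ℝ μ ℝ (by simp)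
  refine DenseRange.induction_on₂ (p := fun φ ψ : Lp ℝ 2 μ =>
    inner ℝ (convolutionOperator μ k φ) ψ = inner ℝ φ (convolutionOperator μ k ψ)) hd
    (isClosed_eq (by fun_prop) (by fun_prop)) (fun f h => ?_) φ ψ
  simp only [convolutionOperator, ContinuousLinearMap.comp_apply]
  rw [ContinuousMap.inner_toLp, ContinuousMap.inner_toLp]
  simp only [innerOperator_convolutionKernel_toLp, conj_trivial, ← integral_const_mul,
    ← integral_mul_const]
  rw [integral_integral_swap_of_hasCompactSupport
    (by simp only [Function.uncurry_def]; fun_prop) (HasCompactSupport.of_compactSpace _)]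
  refine integral_congr_ae (.of_forall fun y => integral_congr_ae (.of_forall fun x => ?_))
  have : k (x⁻¹ * y) = k (y⁻¹ * x) := by rw [← hk]; simp
  simp only [this]
  ring

/-- Left and right translations commute; concretely, translation by `x` is an isometry carrying the
kernel at `x⁻¹ * z` to the kernel at `z`. -/
theorem convolutionOperator_regularRepresentation (k : C(G, ℝ)) (x : G) (φ : Lp ℝ 2 μ) :
    convolutionOperator μ k (regularRepresentation G μ x φ) =
      regularRepresentation G μ x (convolutionOperator μ k φ) := by
  simp only [convolutionOperator, ContinuousLinearMap.comp_apply]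
  rw [regularRepresentation_toLp]
  congr 1
  ext z
  simp only [innerOperator_apply, ContinuousMap.comp_apply, ContinuousMap.coe_mk]
  rw [← LinearIsometryEquiv.inner_map_map (regularRepresentation G μ x)
    (convolutionKernel μ k (x⁻¹ * z)), convolutionKernel_apply, convolutionKernel_apply,
    regularRepresentation_toLp]
  congr 2
  ext y
  simp [mul_assoc]

end RegularRepresentation

/-! ### Peter–Weyl separation -/

section PeterWeyl

open MeasureTheory

variable {G : Type*} [Group G] [TopologicalSpace G] [IsTopologicalGroup G] [CompactSpace G]

/-- Urysohn's lemma on the orbit space of `H`, pulled back to `G`. -/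
theorem exists_continuousMap_left_invariant (H : Subgroup G) (hH : IsClosed (H : Set G)) {g : G}
    (hg : g ∉ H) : ∃ f : C(G, ℝ), (∀ h ∈ H, ∀ x, f (h * x) = f x) ∧ f 1 = 0 ∧ f g = 1 := by
  let X := Quotient (MulAction.orbitRel H G)
  have : CompactSpace X := Quotient.compactSpace
  have hne : (Quotient.mk _ 1 : X) ≠ Quotient.mk _ g := by
    intro h
    obtain ⟨a, ha⟩ := MulAction.orbitRel_apply.1 (Quotient.exact h.symm)
    have ha' : (a : G) * 1 = g := ha
    exact hg (by rw [← ha', mul_one]; exact a.2)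
  obtain ⟨f, h0, h1, -⟩ := exists_continuous_zero_one_of_isClosed
    (isClosed_singleton (x := (Quotient.mk _ 1 : X))) (isClosed_singleton (x := Quotient.mk _ g))
    (by simpa using hne)
  refine ⟨f.comp ⟨Quotient.mk _, continuous_quotient_mk'⟩, fun h hh x => ?_, h0 rfl, h1 rfl⟩
  exact congrArg f (Quotient.sound (MulAction.orbitRel_apply.2 ⟨⟨h, hh⟩, rfl⟩))

/-- In a compact group, a point outside a closed subgroup `H` moves an `H`-fixed vector of some
finite-dimensional orthogonal representation. -/
theorem exists_orthogonal_representation_fixing [T2Space G] (H : Subgroup G) (hH : IsClosed (H : Set G))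
    {g : G} (hg : g ∉ H) :
    ∃ (n : ℕ) (ρ : G →ₜ* Matrix.orthogonalGroup (Fin n) ℝ) (w : Fin n → ℝ),
      (∀ h ∈ H, (ρ h).1.mulVec w = w) ∧ (ρ g).1.mulVec w ≠ w := by
  borelize G
  let μ : Measure G := Measure.haar
  -- The inverse appears because the translate of `f` by `g` takes the value `f g⁻¹` at `1`.
  obtain ⟨f, hfH, hf1, hfg⟩ := exists_continuousMap_left_invariant H hH
    (g := g⁻¹) (by simpa using hg)
  let ι : C(G, ℝ) →L[ℝ] Lp ℝ 2 μ := ContinuousMap.toLp 2 μ ℝ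
  -- With `p` the positive part of `u`, the kernel `k` is symmetric and the convolution of `u` with
  -- `k` at `1` is `∫ p(y)² p(y⁻¹)`. This is positive since `p 1 = 1`, so the operator does not kill
  -- `u`.
  let u : C(G, ℝ) := f.comp ⟨fun y => g⁻¹ * y, by fun_prop⟩ - f
  let p : C(G, ℝ) := ⟨fun y => max (u y) 0, by fun_prop⟩
  let k : C(G, ℝ) := ⟨fun z => p z * p z⁻¹, by fun_prop⟩
  have hk : ∀ x, k x⁻¹ = k x := fun x => by simp [k, mul_comm]
  have hup : ∀ y, u y * p y = p y * p y := fun y => by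
    rcases le_total (u y) 0 with h | h <;> simp [p, h]
  have hp1 : p 1 = 1 := by simp [p, u, hf1, hfg]
  have hp0 : ∀ y, 0 ≤ p y := fun y => le_max_right _ _
  have hpos : 0 < ∫ y, u y * k (y⁻¹ * 1) ∂μ := by
    have : ∀ y, u y * k (y⁻¹ * 1) = p y * p y * p y⁻¹ := fun y => by
      simp only [k, ContinuousMap.coe_mk, mul_one, inv_inv]
      rw [← hup]; ring
    simp only [this]
    refine Continuous.integral_pos_of_hasCompactSupport_nonneg_nonzero (x := 1) (by fun_prop)
      (HasCompactSupport.of_compactSpace _)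
      (fun y => mul_nonneg (mul_nonneg (hp0 _) (hp0 _)) (hp0 _)) (by simp [hp1])
  have hne : convolutionOperator μ k (regularRepresentation G μ g (ι f)) ≠
      convolutionOperator μ k (ι f) := by
    rw [← sub_ne_zero, ← map_sub, regularRepresentation_toLp, ← map_sub]
    intro h0
    have h1 : innerOperator (convolutionKernel μ k) (ι u) = 0 :=
      ContinuousMap.toLp_injective μ (𝕜 := ℝ) (p := 2) (by rw [map_zero]; exact h0)
    have h2 := innerOperator_convolutionKernel_toLp μ k u 1
    rw [← h2] at hpos
    change 0 < innerOperator (convolutionKernel μ k) (ι u) 1 at hpos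
    rw [h1] at hpos
    exact lt_irrefl _ hpos
  obtain ⟨V, hV, hinv, v, hv, hgv, hfix⟩ := exists_finiteDimensional_invariant_submodule
    (regularRepresentation G μ) (isCompactOperator_convolutionOperator μ k)
    (isSymmetric_convolutionOperator μ hk) (convolutionOperator_regularRepresentation μ k) hne
  obtain ⟨n, ρ, w, hw⟩ := exists_continuousMonoidHom_orthogonalGroup
    (regularRepresentation G μ) (continuous_regularRepresentation μ) V hinv ⟨v, hv⟩
  refine ⟨n, ρ, w, fun h hh => (hw h).2 (hfix h ?_), fun h => hgv ((hw g).1 h)⟩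
  rw [regularRepresentation_toLp]
  congr 1
  ext y
  exact hfH _ (H.inv_mem hh) y

theorem exists_orthogonal_representation_ne [T2Space G] {x y : G} (hxy : x ≠ y) :
    ∃ (n : ℕ) (ρ : G →ₜ* Matrix.orthogonalGroup (Fin n) ℝ), ρ x ≠ ρ y := by
  obtain ⟨n, ρ, w, -, hw⟩ := exists_orthogonal_representation_fixing (⊥ : Subgroup G)
    (by simp) (g := x⁻¹ * y) (by simpa [inv_mul_eq_one] using hxy)
  refine ⟨n, ρ, fun h => hw ?_⟩
  simp [map_mul, map_inv, h]

end PeterWeyl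

/-! ### Reflections and pairs of homomorphisms -/

section OrthogonalGroup

open Matrix

variable {m : Type*} [Fintype m] [DecidableEq m]

instance compactSpace_orthogonalGroup : CompactSpace (orthogonalGroup m ℝ) := by
  refine isCompact_iff_compactSpace.1 (IsCompact.of_isClosed_subset
    (isCompact_univ_pi fun _ => isCompact_univ_pi fun _ => isCompact_Icc (a := (-1 : ℝ)) (b := 1))
    (isClosed_unitary (R := Matrix m m ℝ)) fun A hA i _ j _ => ?_)
  exact abs_le.1 (entry_norm_bound_of_unitary hA i j)

/-- The reflection in the hyperplane orthogonal to a nonzero vector. -/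
theorem exists_reflection_matrix {w : m → ℝ} (hw : w ⬝ᵥ w ≠ 0) :
    ∃ s ∈ orthogonalGroup m ℝ, s = 1 - (2 / (w ⬝ᵥ w)) • vecMulVec w w := by
  refine ⟨_, mem_unitaryGroup_iff.2 ?_, rfl⟩
  have h1 : star (1 - (2 / (w ⬝ᵥ w)) • vecMulVec w w) =
      1 - (2 / (w ⬝ᵥ w)) • vecMulVec w w := by
    ext i j
    simp [star_apply, one_apply, vecMulVec_apply, eq_comm, mul_comm]
  have h2 : vecMulVec w w * vecMulVec w w = (w ⬝ᵥ w) • vecMulVec w w := by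
    rw [vecMulVec_mul_vecMulVec, vecMulVec_smul]
  rw [h1, sub_mul, one_mul, mul_sub, mul_one, smul_mul_smul_comm, h2, smul_smul]
  have h3 : 2 / (w ⬝ᵥ w) * (2 / (w ⬝ᵥ w)) * (w ⬝ᵥ w) = 2 / (w ⬝ᵥ w) + 2 / (w ⬝ᵥ w) := by
    field_simp; ring
  rw [h3, add_smul]
  abel

/-- The homomorphism `A ↦ diag(A, 1)` of orthogonal groups. -/
def orthogonalGroupStabilization : orthogonalGroup m ℝ →ₜ* orthogonalGroup (m ⊕ Unit) ℝ where
  toFun A := ⟨fromBlocks A.1 0 0 1, mem_unitaryGroup_iff.2 (by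
    rw [star_eq_conjTranspose, fromBlocks_conjTranspose, fromBlocks_multiply]
    have := mem_unitaryGroup_iff.1 A.2
    rw [star_eq_conjTranspose, conjTranspose_eq_transpose_of_trivial] at this
    simp [this])⟩
  map_one' := Subtype.ext (by simp)
  map_mul' A B := Subtype.ext (by simp [fromBlocks_multiply])
  continuous_toFun := Continuous.subtype_mk
    (continuous_subtype_val.matrix_fromBlocks continuous_const continuous_const
      continuous_const) _

variable {G : Type*} [Group G] [TopologicalSpace G] [IsTopologicalGroup G] [CompactSpace G]
  [T2Space G]

/-- A closed subgroup of a compact group is an intersection of equalizers of pairs of continuous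
homomorphisms to orthogonal groups. -/
theorem exists_continuousMonoidHom_pair (H : Subgroup G) (hH : IsClosed (H : Set G)) {g : G}
    (hg : g ∉ H) :
    ∃ (n : ℕ) (a b : G →ₜ* orthogonalGroup (Fin n ⊕ Unit) ℝ),
      (∀ h ∈ H, a h = b h) ∧ a g ≠ b g := by
  obtain ⟨n, ρ, v, hv, hgv⟩ := exists_orthogonal_representation_fixing H hH hg
  -- The last coordinate `1` makes `w` nonzero and later excludes `a g` sending `w` to `-w`, which
  -- would also commute with the reflection.
  let w : Fin n ⊕ Unit → ℝ := Sum.elim v fun _ => 1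
  have hw : w ⬝ᵥ w ≠ 0 := by
    refine fun h => one_ne_zero (α := ℝ) ?_
    exact congrFun (dotProduct_self_eq_zero.1 h) (Sum.inr ())
  obtain ⟨s, hs, hs'⟩ := exists_reflection_matrix hw
  let a : G →ₜ* orthogonalGroup (Fin n ⊕ Unit) ℝ := orthogonalGroupStabilization.comp ρ
  let σ : orthogonalGroup (Fin n ⊕ Unit) ℝ := ⟨s, hs⟩
  let b : G →ₜ* orthogonalGroup (Fin n ⊕ Unit) ℝ :=
    { toFun := fun x => σ * a x * σ⁻¹
      map_one' := by simp
      map_mul' := fun x y => by simp [mul_assoc]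
      continuous_toFun := by fun_prop }
  have haw : ∀ x, (a x).1.mulVec w = Sum.elim ((ρ x).1.mulVec v) fun _ => 1 := by
    intro x
    change (fromBlocks (ρ x).1 0 0 1).mulVec w = _
    rw [fromBlocks_mulVec]
    ext i
    rcases i with i | i
    · simp [w, Function.comp_def]
    · simp [w, Function.comp_def]
  have hsu : ∀ u, s.mulVec u = u - (2 / (w ⬝ᵥ w) * (w ⬝ᵥ u)) • w := by
    intro u
    rw [hs', sub_mulVec, one_mulVec, smul_mulVec, vecMulVec_mulVec, mul_smul]
    simp
  refine ⟨n, a, b, fun h hh => ?_, fun h => hgv ?_⟩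
  · have h1 : (a h).1.mulVec w = w := by rw [haw, hv h hh]
    have h2 : w ᵥ* (a h).1 = w := by
      have h3 : star (a h).1 * (a h).1 = 1 := mem_unitaryGroup_iff'.1 (a h).2
      rw [star_eq_conjTranspose, conjTranspose_eq_transpose_of_trivial] at h3
      rw [← mulVec_transpose]
      nth_rw 1 [← h1]
      rw [mulVec_mulVec, h3, one_mulVec]
    change a h = σ * a h * σ⁻¹
    rw [eq_mul_inv_iff_mul_eq]
    refine Subtype.ext ?_
    change (a h).1 * s = s * (a h).1
    rw [hs', mul_sub, sub_mul, mul_smul_comm, smul_mul_assoc, mul_vecMulVec, vecMulVec_mul, h1, h2,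
      mul_one, one_mul]
  · have h1 : s * (a g).1 = (a g).1 * s := by
      have : a g = σ * a g * σ⁻¹ := h
      rw [eq_mul_inv_iff_mul_eq] at this
      exact (congrArg Subtype.val this).symm
    -- If `a g` commutes with `s`, it preserves the `-1` eigenspace of `s`, the line through `w`.
    -- Comparing last coordinates then forces `a g` to fix `w`.
    have h2 : s.mulVec ((a g).1.mulVec w) = -(a g).1.mulVec w := by
      rw [mulVec_mulVec, h1, ← mulVec_mulVec, hsu w, div_mul_cancel₀ _ hw, ← mulVec_neg]
      congr 1
      rw [two_smul]
      abel
    rw [hsu, haw] at h2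
    set c := 2 / (w ⬝ᵥ w) * (w ⬝ᵥ Sum.elim ((ρ g).1.mulVec v) fun _ => 1)
    have hc : 1 - c = -1 := by simpa [w] using congrFun h2 (Sum.inr ())
    ext i
    have hi : (ρ g).1.mulVec v i - c * v i = -(ρ g).1.mulVec v i := by
      simpa [w] using congrFun h2 (Sum.inl i)
    have hc' : c = 2 := by linarith
    rw [hc'] at hi
    linarith

end OrthogonalGroup

/-! ### Part (a) -/

section RegularMono

/-- In a category with regular monomorphisms, the pushout square of a coherently embeddable pair
is a pullback square. -/
theorem CoherentlyEmbeddable.isPullback {C : Type u} [Category.{v} C] [IsRegularMonoCategory C]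
    {H G₀ G₁ P : C} {ι₀ : H ⟶ G₀} {ι₁ : H ⟶ G₁} [Mono ι₀] {p₀ : G₀ ⟶ P} {p₁ : G₁ ⟶ P}
    (h : CoherentlyEmbeddable ι₀ ι₁) (hP : IsPushout ι₀ ι₁ p₀ p₁) : IsPullback ι₀ ι₁ p₀ p₁ := by
  obtain ⟨G, j₀, j₁, _, _, hj⟩ := h
  let q := ι₀ ≫ j₀
  have : IsRegularMono q := IsRegularMonoCategory.regularMonoOfMono q
  let r := IsRegularMono.getStruct q
  have hψ : ι₀ ≫ j₀ ≫ r.left = ι₁ ≫ j₁ ≫ r.right := by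
    rw [← Category.assoc, ← Category.assoc, ← hj]
    exact r.w
  let φ : P ⟶ G := hP.desc j₀ j₁ hj
  let ψ : P ⟶ r.Z := hP.desc (j₀ ≫ r.left) (j₁ ≫ r.right) hψ
  have hψ₀ : p₀ ≫ ψ = j₀ ≫ r.left := hP.inl_desc _ _ _
  have hψ₁ : p₁ ≫ ψ = j₁ ≫ r.right := hP.inr_desc _ _ _
  have hφ₀ : p₀ ≫ φ = j₀ := hP.inl_desc _ _ _
  have hφ₁ : p₁ ≫ φ = j₁ := hP.inr_desc _ _ _
  have hfac : ∀ {X : C} (a : X ⟶ G₀) (b : X ⟶ G₁), a ≫ p₀ = b ≫ p₁ →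
      ∃ l : X ⟶ H, l ≫ ι₀ = a ∧ l ≫ ι₁ = b := by
    intro X a b hab
    have hj' : a ≫ j₀ = b ≫ j₁ := by
      rw [← hφ₀, ← hφ₁, reassoc_of% hab]
    obtain ⟨l, hl⟩ := r.lift' (a ≫ j₀) (by
      rw [Category.assoc, ← hψ₀, reassoc_of% hab, hψ₁, ← Category.assoc b, hj'])
    refine ⟨l, (cancel_mono j₀).1 (by simpa [q] using hl), (cancel_mono j₁).1 ?_⟩
    rw [Category.assoc, ← hj, ← hj']
    exact hl
  refine ⟨hP.toCommSq, ⟨PullbackCone.IsLimit.mk _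
    (fun s => (hfac s.fst s.snd s.condition).choose)
    (fun s => (hfac s.fst s.snd s.condition).choose_spec.1)
    (fun s => (hfac s.fst s.snd s.condition).choose_spec.2) fun s m hm _ => ?_⟩⟩
  rw [← cancel_mono ι₀, hm, (hfac s.fst s.snd s.condition).choose_spec.1]

end RegularMono

/-! ### Part (b): injectivity and intersection -/

namespace CompactGrp

/-- A closed subgroup of a compact group. -/
def ofSubgroup {A : Type u} [Group A] [TopologicalSpace A] [IsTopologicalGroup A]
    [CompactSpace A] [T2Space A] (K : Subgroup A) (hK : IsClosed (K : Set A)) : CompactGrp.{u} :=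
  have := isCompact_iff_compactSpace.1 hK.isCompact
  ⟨K⟩

/-- The inclusion of the kernel and the trivial map have the same composite with `f`, so they
coincide. -/
theorem injective_of_mono {A B : CompactGrp.{u}} (f : A ⟶ B) [Mono f] : Function.Injective f := by
  have hK : IsClosed (f.hom'.toMonoidHom.ker : Set A) :=
    isClosed_singleton.preimage f.hom'.continuous_toFun
  let K := ofSubgroup f.hom'.toMonoidHom.ker hK
  let i : K ⟶ A := ⟨⟨f.hom'.toMonoidHom.ker.subtype, continuous_subtype_val⟩⟩
  let t : K ⟶ A := ⟨1⟩
  have hit : i = t := by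
    rw [← cancel_mono f]
    refine Hom.ext (ContinuousMonoidHom.ext fun x => ?_)
    change f.hom' x.1 = f.hom' 1
    rw [map_one]
    exact x.2
  refine (injective_iff_map_eq_one f.hom').2 fun a ha => ?_
  exact congrArg (fun k : K ⟶ A => k.hom' ⟨a, ha⟩) hit

/-- The orthogonal group of a finite-dimensional Euclidean space, in any universe. -/
def orthogonal (m : Type) [Fintype m] [DecidableEq m] : CompactGrp.{u} :=
  ⟨ULift.{u} (Matrix.orthogonalGroup m ℝ)⟩

/-- A homomorphism from a compact group to an orthogonal group, as a morphism. -/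
def homOrthogonal {A : CompactGrp.{u}} {m : Type} [Fintype m] [DecidableEq m]
    (a : A →ₜ* Matrix.orthogonalGroup m ℝ) : A ⟶ orthogonal.{u} m :=
  ⟨{ toFun := fun x => ULift.up (a x)
     map_one' := by rw [map_one]; rfl
     map_mul' := fun x y => by rw [map_mul]; rfl
     continuous_toFun := continuous_uliftUp.comp a.continuous_toFun }⟩

theorem _root_.CoherentlyEmbeddable.injective_and_range_inter {H G₀ G₁ P : CompactGrp.{u}}
    {ι₀ : H ⟶ G₀} {ι₁ : H ⟶ G₁} {p₀ : G₀ ⟶ P} {p₁ : G₁ ⟶ P}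
    (h : CoherentlyEmbeddable ι₀ ι₁) (hP : IsPushout ι₀ ι₁ p₀ p₁) :
    Function.Injective p₀ ∧ Function.Injective p₁ ∧
      Set.range p₀ ∩ Set.range p₁ = Set.range (ι₀ ≫ p₀) := by
  obtain ⟨G, j₀, j₁, _, _, hj⟩ := h
  have hφ₀ : ∀ x, hP.desc j₀ j₁ hj (p₀ x) = j₀ x := fun x => by
    rw [← ConcreteCategory.comp_apply, hP.inl_desc]
  have hφ₁ : ∀ x, hP.desc j₀ j₁ hj (p₁ x) = j₁ x := fun x => by
    rw [← ConcreteCategory.comp_apply, hP.inr_desc]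
  refine ⟨fun x y hxy => injective_of_mono j₀ ?_, fun x y hxy => injective_of_mono j₁ ?_,
    Set.Subset.antisymm ?_ ?_⟩
  · rw [← hφ₀, ← hφ₀, hxy]
  · rw [← hφ₁, ← hφ₁, hxy]
  · rintro _ ⟨⟨x, rfl⟩, ⟨y, hxy⟩⟩
    let q := ι₀ ≫ j₀
    let K : Subgroup G := q.hom'.toMonoidHom.range
    have hK : IsClosed (K : Set G) := (isCompact_range q.hom'.continuous_toFun).isClosed
    have hx : j₀ x = j₁ y := by rw [← hφ₀, ← hφ₁, hxy]
    by_cases hmem : j₀ x ∈ K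
    · obtain ⟨z, hz⟩ := hmem
      have hz' : ι₀ z = x := injective_of_mono j₀ hz
      exact ⟨z, by rw [ConcreteCategory.comp_apply, hz']⟩
    · obtain ⟨n, a, b, hab, hne⟩ := exists_continuousMonoidHom_pair K hK hmem
      -- Agreement of `a` and `b` on `K` makes this a cocone; the induced map sends `p₀ x = p₁ y` to
      -- both `a (j₀ x)` and `b (j₀ x)`.
      have hw : ι₀ ≫ j₀ ≫ homOrthogonal a = ι₁ ≫ j₁ ≫ homOrthogonal b := by
        rw [← Category.assoc, ← Category.assoc, ← hj]
        exact ConcreteCategory.hom_ext _ _ fun z => congrArg ULift.up (hab _ ⟨z, rfl⟩)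
      have h₀ : hP.desc _ _ hw (p₀ x) = ULift.up (a (j₀ x)) := by
        rw [← ConcreteCategory.comp_apply, hP.inl_desc]; rfl
      have h₁ : hP.desc _ _ hw (p₁ y) = ULift.up (b (j₁ y)) := by
        rw [← ConcreteCategory.comp_apply, hP.inr_desc]; rfl
      rw [← hxy, h₁, ← hx] at h₀
      exact absurd (ULift.up_injective h₀).symm hne
  · rintro _ ⟨z, rfl⟩
    refine ⟨⟨ι₀ z, by rw [ConcreteCategory.comp_apply]⟩, ι₁ z, ?_⟩
    rw [hP.w, ConcreteCategory.comp_apply]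

/-! ### Existence of pushouts -/

section Pushouts

variable {H A B : CompactGrp.{u}} (f : H ⟶ A) (g : H ⟶ B)

/-- Pairs of orthogonal representations of the two legs of a span that agree on its source. -/
def OrthogonalCocone : Type u :=
  Σ n : ℕ, {p : (A →ₜ* Matrix.orthogonalGroup (Fin n) ℝ) ×
      (B →ₜ* Matrix.orthogonalGroup (Fin n) ℝ) //
    p.1.comp f.hom' = p.2.comp g.hom'}

/-- The product of the targets of all orthogonal cocones under a span. -/
abbrev OrthogonalProduct : Type u :=
  ∀ j : OrthogonalCocone f g, Matrix.orthogonalGroup (Fin j.1) ℝ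

/-- The first leg of a span, mapped to the product of all orthogonal cocones. -/
def orthogonalProductInl : A →ₜ* OrthogonalProduct f g where
  toFun x j := j.2.1.1 x
  map_one' := by ext1 j; exact map_one _
  map_mul' x y := by ext1 j; exact map_mul _ x y
  continuous_toFun := continuous_pi fun j => j.2.1.1.continuous_toFun

/-- The second leg of a span, mapped to the product of all orthogonal cocones. -/
def orthogonalProductInr : B →ₜ* OrthogonalProduct f g where
  toFun x j := j.2.1.2 x
  map_one' := by ext1 j; exact map_one _
  map_mul' x y := by ext1 j; exact map_mul _ x y
  continuous_toFun := continuous_pi fun j => j.2.1.2.continuous_toFun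

/-- The closed subgroup of the product of all orthogonal cocones generated by the two legs. -/
def pushoutSubgroup : Subgroup (OrthogonalProduct f g) :=
  ((orthogonalProductInl f g).toMonoidHom.range ⊔
    (orthogonalProductInr f g).toMonoidHom.range).topologicalClosure

variable {f g} in
theorem pushoutSubgroup_le {K : Subgroup (OrthogonalProduct f g)}
    (hK : IsClosed (K : Set (OrthogonalProduct f g)))
    (hl : ∀ x, orthogonalProductInl f g x ∈ K) (hr : ∀ x, orthogonalProductInr f g x ∈ K) :
    pushoutSubgroup f g ≤ K := by
  refine Subgroup.topologicalClosure_minimal _ (sup_le ?_ ?_) hK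
  · rintro _ ⟨x, rfl⟩
    exact hl x
  · rintro _ ⟨x, rfl⟩
    exact hr x

theorem isClosed_pushoutSubgroup :
    IsClosed (pushoutSubgroup f g : Set (OrthogonalProduct f g)) :=
  Subgroup.isClosed_topologicalClosure _

/-- An explicit pushout of compact groups. -/
def pushoutObj : CompactGrp.{u} := ofSubgroup (pushoutSubgroup f g) (isClosed_pushoutSubgroup f g)

/-- The first structure map of the explicit pushout. -/
def pushoutInl : A ⟶ pushoutObj f g :=
  ⟨{ toFun := fun x => ⟨orthogonalProductInl f g x,
      Subgroup.le_topologicalClosure _ (Subgroup.mem_sup_left ⟨x, rfl⟩)⟩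
     map_one' := Subtype.ext (map_one (orthogonalProductInl f g))
     map_mul' := fun x y => Subtype.ext (map_mul (orthogonalProductInl f g) x y)
     continuous_toFun := (orthogonalProductInl f g).continuous_toFun.subtype_mk _ }⟩

/-- The second structure map of the explicit pushout. -/
def pushoutInr : B ⟶ pushoutObj f g :=
  ⟨{ toFun := fun x => ⟨orthogonalProductInr f g x,
      Subgroup.le_topologicalClosure _ (Subgroup.mem_sup_right ⟨x, rfl⟩)⟩
     map_one' := Subtype.ext (map_one (orthogonalProductInr f g))
     map_mul' := fun x y => Subtype.ext (map_mul (orthogonalProductInr f g) x y)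
     continuous_toFun := (orthogonalProductInr f g).continuous_toFun.subtype_mk _ }⟩

theorem pushout_w : f ≫ pushoutInl f g = g ≫ pushoutInr f g := by
  refine Hom.ext (ContinuousMonoidHom.ext fun x => Subtype.ext (funext fun j => ?_))
  exact DFunLike.congr_fun j.2.2 x

variable {f g}

/-- The locus where `d` and `e` agree is a closed subgroup containing the topological generators. -/
theorem pushout_hom_ext {Z : CompactGrp.{u}} {d e : pushoutObj f g ⟶ Z}
    (hl : pushoutInl f g ≫ d = pushoutInl f g ≫ e)
    (hr : pushoutInr f g ≫ d = pushoutInr f g ≫ e) : d = e := by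
  let L : Subgroup (pushoutSubgroup f g) := d.hom'.toMonoidHom.eqLocus e.hom'.toMonoidHom
  have hL : IsClosed (L : Set (pushoutSubgroup f g)) :=
    isClosed_eq d.hom'.continuous_toFun e.hom'.continuous_toFun
  have hle : pushoutSubgroup f g ≤ L.map (pushoutSubgroup f g).subtype := by
    refine pushoutSubgroup_le ?_ (fun x => ?_) fun x => ?_
    · exact (isClosed_pushoutSubgroup f g).isClosedEmbedding_subtypeVal.isClosedMap _ hL
    · exact ⟨(pushoutInl f g).hom' x, congrArg (fun k : A ⟶ Z => k.hom' x) hl, rfl⟩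
    · exact ⟨(pushoutInr f g).hom' x, congrArg (fun k : B ⟶ Z => k.hom' x) hr, rfl⟩
  refine Hom.ext (ContinuousMonoidHom.ext fun p => ?_)
  obtain ⟨p', hp', hpp⟩ := hle p.2
  rw [← (Subtype.ext hpp : p' = p)]
  exact hp'

/-- `Z` is a closed subgroup of the product of its orthogonal representations. Each pulls back along
`a` and `b` to an orthogonal cocone, so selecting those coordinates sends the generators, hence the
whole pushout, into the image of `Z`. -/
theorem exists_pushout_desc {Z : CompactGrp.{u}} (a : A ⟶ Z) (b : B ⟶ Z) (hab : f ≫ a = g ≫ b) :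
    ∃ d : pushoutObj f g ⟶ Z, pushoutInl f g ≫ d = a ∧ pushoutInr f g ≫ d = b := by
  let J := Σ n : ℕ, Z →ₜ* Matrix.orthogonalGroup (Fin n) ℝ
  let e : Z →ₜ* (∀ j : J, Matrix.orthogonalGroup (Fin j.1) ℝ) :=
    { toFun := fun z j => j.2 z
      map_one' := by ext1 j; exact map_one _
      map_mul' := fun x y => by ext1 j; exact map_mul _ x y
      continuous_toFun := continuous_pi fun j => j.2.continuous_toFun }
  have hinj : Function.Injective e := by
    intro x y hxy
    by_contra hne
    obtain ⟨n, ρ, hρ⟩ := exists_orthogonal_representation_ne hne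
    exact hρ (congrFun hxy ⟨n, ρ⟩)
  have hemb : Topology.IsClosedEmbedding e := e.continuous_toFun.isClosedEmbedding hinj
  let τ : J → OrthogonalCocone f g := fun j =>
    ⟨j.1, (j.2.comp a.hom', j.2.comp b.hom'), ContinuousMonoidHom.ext fun x =>
      congrArg (fun k : H ⟶ Z => j.2 (k.hom' x)) hab⟩
  let r : OrthogonalProduct f g →ₜ* (∀ j : J, Matrix.orthogonalGroup (Fin j.1) ℝ) :=
    { toFun := fun p j => p (τ j)
      map_one' := rfl
      map_mul' := fun _ _ => rfl
      continuous_toFun := continuous_pi fun j => continuous_apply (τ j) }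
  have hle : pushoutSubgroup f g ≤ e.toMonoidHom.range.comap r.toMonoidHom := by
    refine pushoutSubgroup_le ?_ (fun x => ?_) fun x => ?_
    · exact hemb.isClosed_range.preimage r.continuous_toFun
    · exact ⟨a.hom' x, rfl⟩
    · exact ⟨b.hom' x, rfl⟩
  choose d hd using fun p : pushoutSubgroup f g => hle p.2
  have hd' : ∀ p, e (d p) = r p.1 := hd
  let D : pushoutSubgroup f g →ₜ* Z :=
    { toFun := d
      map_one' := hinj (by rw [hd', map_one]; exact map_one r)
      map_mul' := fun p q => hinj (by rw [map_mul, hd', hd', hd']; exact map_mul r p.1 q.1)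
      continuous_toFun := by
        rw [hemb.continuous_iff, show e ∘ d = fun p => r p.1 from funext hd']
        exact r.continuous_toFun.comp continuous_subtype_val }
  refine ⟨⟨D⟩, ?_, ?_⟩
  · exact Hom.ext (ContinuousMonoidHom.ext fun x => hinj (hd' _))
  · exact Hom.ext (ContinuousMonoidHom.ext fun x => hinj (hd' _))

variable (f g)

theorem isPushout_pushoutObj : IsPushout f g (pushoutInl f g) (pushoutInr f g) :=
  ⟨⟨pushout_w f g⟩, ⟨PushoutCocone.IsColimit.mk _
    (fun s => (exists_pushout_desc s.inl s.inr s.condition).choose)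
    (fun s => (exists_pushout_desc s.inl s.inr s.condition).choose_spec.1)
    (fun s => (exists_pushout_desc s.inl s.inr s.condition).choose_spec.2)
    fun s m hl hr => by
      obtain ⟨h₁, h₂⟩ := (exists_pushout_desc s.inl s.inr s.condition).choose_spec
      exact pushout_hom_ext (hl.trans h₁.symm) (hr.trans h₂.symm)⟩⟩

instance : HasPushouts CompactGrp.{u} :=
  have {H A B : CompactGrp.{u}} {f : H ⟶ A} {g : H ⟶ B} : HasColimit (span f g) :=
    (isPushout_pushoutObj f g).hasPushout
  hasPushouts_of_hasColimit_span _

end Pushouts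

end CompactGrp

theorem mainTheorem12 :
    (∀ (C : Type u) [Category.{v} C] [HasPushouts C] [IsRegularMonoCategory C]
      (H G₀ G₁ P : C) (ι₀ : H ⟶ G₀) (ι₁ : H ⟶ G₁) [Mono ι₀] [Mono ι₁]
      (p₀ : G₀ ⟶ P) (p₁ : G₁ ⟶ P),
      CoherentlyEmbeddable ι₀ ι₁ → IsPushout ι₀ ι₁ p₀ p₁ → IsPullback ι₀ ι₁ p₀ p₁) ∧
    HasPushouts CompactGrp.{w} ∧
    (∀ (H G₀ G₁ P : CompactGrp.{w}) (ι₀ : H ⟶ G₀) (ι₁ : H ⟶ G₁) [Mono ι₀] [Mono ι₁]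
      (p₀ : G₀ ⟶ P) (p₁ : G₁ ⟶ P),
      CoherentlyEmbeddable ι₀ ι₁ → IsPushout ι₀ ι₁ p₀ p₁ →
        Function.Injective p₀ ∧ Function.Injective p₁ ∧
        Set.range p₀ ∩ Set.range p₁ = Set.range (ι₀ ≫ p₀)) :=
  ⟨fun _ _ _ _ _ _ _ _ _ _ _ _ _ _ h hP => h.isPullback hP, inferInstance,
    fun _ _ _ _ _ _ _ _ _ _ h hP => h.injective_and_range_inter hP⟩
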